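/- Let $F$ be $\mathbb{R}$ or $\mathbb{C}$, with normalized absolute value $|\cdot|$ (so $|z|=z\bar z$ if $F=\mathbb{C}$), let $n\ge 1$, and let $(\pi,V)$ be an irreducible admissible smooth Fréchet representation of moderate growth of $GL_{2n}(F)$. Moderate growth means that for every continuous seminorm $\alpha$ on $V$ there are a continuous seminorm $\beta$ on $V$ and $N\in\mathbb{N}$ with $\alpha(\pi(g)v)\le\beta(v)\|g\|^N$ for all $g\in GL_{2n}(F)$ and $v\in V$, where $\|g\|=\sum_{i,j}|g_{ij}|_0^2+\sum_{i,j}|(g^{-1})_{ij}|_0^2$ and $|\cdot|_0$ is the usual absolute value. Let $\lambda$ be a Shalika functional on $V$, that is, a continuous linear functional $\lambda:V\to\mathbb{C}$ with $$\lambda\left(\pi\begin{pmatrix} g & A\\ 0 & g\end{pmatrix}v\right)=e^{2\pi i\operatorname{Re}\operatorname{Tr}(g^{-1}A)}\,\lambda(v)\qquad (g\in GL_n(F),\ A\in \mathrm{Mat}_{n\times n}(F),\ v\in V).$$ Fix a Haar measure $dg$ on $GL_n(F)$ and put $$L_{\lambda,v}(s)=\int_{GL_n(F)}\lambda\left(\pi\begin{pmatrix}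 g & 0\\ 0 & 1\end{pmatrix}v\right)|\det g|^{s-\frac12}\,dg .$$ Then there is a real number $M>0$ such that this integral converges absolutely for all $v\in V$ and all $s\in\mathbb{C}$ with $\operatorname{Re}s>M$, and such that for every even integer $M'\ge 2$ and every polynomial $p\in\mathbb{C}[s]$ there is a continuous seminorm $\beta$ on $V$ with $$|p(s)L_{\lambda,v}(s)|\le\beta(v)\qquad\text{for all } v\in V \text{ and all } s\in\mathbb{C} \text{ with } \operatorname{Re}s=M'+M .$$ -/

import Mathlib

open Filter Topology MeasureTheory

namespace Shalika

noncomputable section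

/-! Notation: `F` is `ℝ` or `ℂ` (`RCLike F`). `GL (Fin n ⊕ Fin n) F` is `GL_{2n}(F)`, with its
elements written in `n × n` blocks. -/

/-- The normalized absolute value of `F`: `|x|` if `F = ℝ`, and `|z|_ℂ = z * conj z` if `F = ℂ`. -/
def nabs {F : Type*} [RCLike F] (x : F) : ℝ := ‖x‖ ^ Module.finrank ℝ F

/-- The block matrix `(a A; 0 b)` as an element of `GL_{2n}(F)`. -/
def blockUpper {F : Type*} [RCLike F] {n : ℕ} (a b : GL (Fin n) F)
    (A : Matrix (Fin n) (Fin n) F) : GL (Fin n ⊕ Fin n) F where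
  val := Matrix.fromBlocks (a : Matrix (Fin n) (Fin n) F) A 0 (b : Matrix (Fin n) (Fin n) F)
  inv := Matrix.fromBlocks ((a⁻¹ : GL (Fin n) F) : Matrix (Fin n) (Fin n) F)
    (-(((a⁻¹ : GL (Fin n) F) : Matrix (Fin n) (Fin n) F) * A *
      ((b⁻¹ : GL (Fin n) F) : Matrix (Fin n) (Fin n) F)))
    0 ((b⁻¹ : GL (Fin n) F) : Matrix (Fin n) (Fin n) F)
  val_inv := by
    rw [Matrix.fromBlocks_multiply, ← Matrix.fromBlocks_one]
    congr 1 <;> simp [← mul_assoc]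
  inv_val := by
    rw [Matrix.fromBlocks_multiply, ← Matrix.fromBlocks_one]
    congr 1 <;> simp [mul_assoc]

/-- The embedding `ν(g) = (g 0; 0 1)` of `GL_n(F)` into `GL_{2n}(F)`, with image `G₁`. -/
def nu {F : Type*} [RCLike F] {n : ℕ} (g : GL (Fin n) F) : GL (Fin n ⊕ Fin n) F :=
  blockUpper g 1 0

/-- `‖g‖ = ∑ |g_{ij}|² + ∑ |(g⁻¹)_{ij}|²`. -/
def groupNorm {F : Type*} [RCLike F] {m : Type*} [Fintype m] [DecidableEq m] (g : GL m F) : ℝ :=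
  ∑ i, ∑ j, ‖(g : Matrix m m F) i j‖ ^ 2 +
    ∑ i, ∑ j, ‖((g⁻¹ : GL m F) : Matrix m m F) i j‖ ^ 2

/-- `f` is of class `C^k` on the open subset `U` of the (finite-dimensional) real vector space `E`,
with values in the topological vector space `V`: `f` is continuous on `U` and, if `k > 0`, it has at
every point of `U` a derivative in every direction `X`, each of which is of class `C^(k-1)`. -/
def IsCk {E V : Type*} [AddCommGroup E] [Module ℝ E] [TopologicalSpace E]
    [AddCommGroup V] [Module ℝ V] [TopologicalSpace V] (U : Set E) : ℕ → (E → V) → Prop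
  | 0, f => ContinuousOn f U
  | k + 1, f => ContinuousOn f U ∧ ∃ f' : E → E → V,
      (∀ A ∈ U, ∀ X : E,
        Tendsto (fun t : ℝ => t⁻¹ • (f (A + t • X) - f A)) (𝓝[≠] 0) (𝓝 (f' X A))) ∧
      ∀ X : E, IsCk U k (f' X)

section Rep

variable {F : Type*} [RCLike F] {m : Type*} [Fintype m] [DecidableEq m]
  {V : Type*} [AddCommGroup V] [Module ℂ V] [TopologicalSpace V] [IsTopologicalAddGroup V]
  [ContinuousSMul ℂ V]

/-- The orbit map `g ↦ π(g)v`, as a function on the space of all matrices: it is extended by zero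
from the open subset of the invertible ones. -/
def orbitMap (π : GL m F →* (V →L[ℂ] V)) (v : V) : Matrix m m F → V :=
  Function.extend (Units.val : GL m F → Matrix m m F) (fun g => π g v) 0

/-- `v` is a smooth vector: `g ↦ π(g)v` is a `C^∞` map on `GL_m(F)`, viewed as a real manifold
(an open subset of the real vector space of matrices). -/
def IsSmoothVector (π : GL m F →* (V →L[ℂ] V)) (v : V) : Prop :=
  ∀ k : ℕ, IsCk {A : Matrix m m F | IsUnit A} k (orbitMap π v)

/-- The restriction of `π` to the standard maximal compact subgroup `K` of `GL_m(F)`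
(`O(m)` if `F = ℝ`, `U(m)` if `F = ℂ`), as an algebraic representation. -/
def restrictK (π : GL m F →* (V →L[ℂ] V)) : Representation ℂ (Matrix.unitaryGroup m F) V :=
  ((ContinuousLinearMap.toLinearMapRingHom : (V →L[ℂ] V) →+* (V →ₗ[ℂ] V)) :
    (V →L[ℂ] V) →* (V →ₗ[ℂ] V)).comp (π.comp (Unitary.toUnits (R := Matrix m m F)))

/-- Admissibility: every irreducible finite-dimensional continuous representation of `K` occurs in
`π` with finite multiplicity. -/
def IsAdmissible (π : GL m F →* (V →L[ℂ] V)) : Prop :=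
  ∀ (d : ℕ) (τ : Representation ℂ (Matrix.unitaryGroup m F) (Fin d → ℂ)),
    (∀ w, Continuous fun k => τ k w) → τ.IsIrreducible →
      FiniteDimensional ℂ (Representation.IntertwiningMap τ (restrictK π))

/-- (Topological) irreducibility: `V ≠ 0`, and `0` and `V` are the only closed invariant subspaces. -/
def IsIrred (π : GL m F →* (V →L[ℂ] V)) : Prop :=
  Nontrivial V ∧ ∀ W : Submodule ℂ V, IsClosed (W : Set V) →
    (∀ g, ∀ v ∈ W, π g v ∈ W) → W = ⊥ ∨ W = ⊤

/-- Moderate growth: for every continuous seminorm `α` there are a continuous seminorm `β` and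
`N ∈ ℕ` with `α(π(g)v) ≤ β(v) ‖g‖ ^ N` for all `g` and `v`. -/
def HasModerateGrowth (π : GL m F →* (V →L[ℂ] V)) : Prop :=
  ∀ α : Seminorm ℂ V, Continuous α → ∃ β : Seminorm ℂ V, Continuous β ∧ ∃ N : ℕ,
    ∀ g v, α (π g v) ≤ β v * groupNorm g ^ N

/-- Irreducible admissible smooth representations of `GL_m(F)` (of moderate growth). The space `V`
is meant to be a Fréchet space. -/
structure IsIrredAdmSmoothRep (π : GL m F →* (V →L[ℂ] V)) : Prop where
  continuous_action : Continuous fun x : GL m F × V => π x.1 x.2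
  smooth : ∀ v, IsSmoothVector π v
  moderateGrowth : HasModerateGrowth π
  admissible : IsAdmissible π
  irreducible : IsIrred π

end Rep

section Functional

variable {F : Type*} [RCLike F] {n : ℕ}
  {V : Type*} [AddCommGroup V] [Module ℂ V] [TopologicalSpace V]

/-- A Shalika functional: a continuous linear functional `ℓ` with
`ℓ(π(g A; 0 g) v) = exp(2πi Re Tr(g⁻¹A)) ℓ(v)`. -/
def IsShalikaFunctional (π : GL (Fin n ⊕ Fin n) F →* (V →L[ℂ] V)) (ℓ : V →L[ℂ] ℂ) : Prop :=
  ∀ (g : GL (Fin n) F) (A : Matrix (Fin n) (Fin n) F) (v : V),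
    ℓ (π (blockUpper g g A) v) =
      Complex.exp (2 * Real.pi * Complex.I *
        (RCLike.re (((g⁻¹ : GL (Fin n) F) : Matrix (Fin n) (Fin n) F) * A).trace : ℝ)) * ℓ v

/-- The function `g ↦ ℓ(π(ν(g))v) |det g|^(s - 1/2)` on `GL_n(F)`. -/
def integrand (π : GL (Fin n ⊕ Fin n) F →* (V →L[ℂ] V)) (ℓ : V →L[ℂ] ℂ) (v : V) (s : ℂ)
    (g : GL (Fin n) F) : ℂ :=
  ℓ (π (nu g) v) * (nabs (g : Matrix (Fin n) (Fin n) F).det : ℂ) ^ (s - 1 / 2)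

/-- `L_{ℓ,v}(s) = ∫ ℓ(π(ν(g))v) |det g|^(s - 1/2) dg`, the integral over `GL_n(F) ≅ G₁` with respect
to the measure `dg` (meaningful for those `s` for which it converges absolutely). -/
def L [MeasurableSpace (GL (Fin n) F)] (dg : Measure (GL (Fin n) F))
    (π : GL (Fin n ⊕ Fin n) F →* (V →L[ℂ] V)) (ℓ : V →L[ℂ] ℂ) (v : V) (s : ℂ) : ℂ :=
  ∫ g, integrand π ℓ v s g ∂dg

end Functional

end

end Shalika

namespace Shalika

set_option linter.unusedSectionVars false

/-! ### Haar measure on the unit group of a finite-dimensional real algebra. -/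

section UnitsHaar

variable {R : Type*} [NormedRing R] [NormedAlgebra ℝ R]

/-! Multiplication operators on the functions `g ↦ ℓ (π (nu g) v)`, and on `L` itself, come from
continuous operators on `V`. Differentiating along the unipotent radical multiplies these functions
by linear forms in `g`, so any power of `1 + sqNorm g` can be absorbed into `v`
(`exists_pow_multiplier`). With moderate growth this gives rapid decay as `g` grows. Near `det g =
0` the growth of `g⁻¹` has a pole of bounded order, which a high power of the determinant cancels
(`exists_integrable_dominating`). Both together give absolute convergence and a seminorm bound on
each vertical line (`exists_abscissa`). Differentiating along the scalars `1 + t` multiplies `L` by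
a linear polynomial in `s`, so every `p(s)` is also absorbed into `v` (`exists_dilation_derivative`,
`exists_polynomial_operator`), and the line bound applies to the new vector. -/

lemma algebraNorm_unit_ne_zero (u : Rˣ) : Algebra.norm ℝ (u : R) ≠ 0 :=
  (u.isUnit.map (Algebra.norm ℝ)).ne_zero

variable [FiniteDimensional ℝ R]

lemma continuous_algebraNorm : Continuous fun a : R => Algebra.norm ℝ a := by
  have h : (fun a : R => Algebra.norm ℝ a) =
      fun a => (Algebra.leftMulMatrix (Module.finBasis ℝ R) a).det := by
    ext a; exact Algebra.norm_eq_matrix_det _ _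
  rw [h]
  exact Continuous.matrix_det
    (LinearMap.continuous_of_finiteDimensional
      (Algebra.leftMulMatrix (Module.finBasis ℝ R)).toLinearMap)

lemma isOpenEmbedding_unitsVal : IsOpenEmbedding (Units.val : Rˣ → R) :=
  have : CompleteSpace R := FiniteDimensional.complete ℝ R
  Units.isOpenEmbedding_val

lemma locallyCompactSpace_units : LocallyCompactSpace Rˣ :=
  have : ProperSpace R := FiniteDimensional.proper ℝ R
  isOpenEmbedding_unitsVal.locallyCompactSpace

lemma continuous_density :
    Continuous fun u : Rˣ => |Algebra.norm ℝ (u : R)|⁻¹ :=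
  ((continuous_algebraNorm.comp Units.continuous_val).abs).inv₀
    fun u => abs_ne_zero.2 (algebraNorm_unit_ne_zero u)

variable [MeasurableSpace Rˣ] [BorelSpace Rˣ] [MeasurableSpace R] [BorelSpace R]

/-- The measure `|N(a)|⁻¹ da` on the group of units of a finite-dimensional real algebra. -/
noncomputable def unitsMeasure (μ : Measure R) : Measure Rˣ :=
  (μ.comap Units.val).withDensity fun u => ENNReal.ofReal |Algebra.norm ℝ (u : R)|⁻¹

lemma measurableEmbedding_unitsVal : MeasurableEmbedding (Units.val : Rˣ → R) :=
  isOpenEmbedding_unitsVal.measurableEmbedding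

lemma measurable_mul_left_units (g : Rˣ) : Measurable fun u : Rˣ => g * u :=
  (continuous_const.mul continuous_id).measurable

lemma lintegral_unitsMeasure (μ : Measure R) (f : Rˣ → ENNReal) (hf : Measurable f) :
    ∫⁻ u, f u ∂(unitsMeasure μ) =
      ∫⁻ u, ENNReal.ofReal |Algebra.norm ℝ (u : R)|⁻¹ * f u ∂(μ.comap Units.val) := by
  rw [unitsMeasure, lintegral_withDensity_eq_lintegral_mul _
    continuous_density.measurable.ennreal_ofReal hf]
  rfl

/-- Left multiplication by `g` is the restriction of a linear map of `R` whose determinant is the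
algebra norm of `g`; the density of `unitsMeasure` cancels this factor. -/
lemma map_mul_left_comap_unitsVal (μ : Measure R) [μ.IsAddHaarMeasure] (g : Rˣ) :
    (μ.comap Units.val).map (fun u : Rˣ => g * u) =
      ENNReal.ofReal |Algebra.norm ℝ (g : R)|⁻¹ • μ.comap Units.val := by
  ext s hs
  rw [Measure.map_apply (measurable_mul_left_units g) hs, Measure.smul_apply,
    measurableEmbedding_unitsVal.comap_apply, measurableEmbedding_unitsVal.comap_apply]
  have h : Units.val '' ((fun u : Rˣ => g * u) ⁻¹' s) =
      LinearMap.mulLeft ℝ (g : R) ⁻¹' (Units.val '' s) := by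
    ext a
    constructor
    · rintro ⟨u, hu, rfl⟩
      exact ⟨g * u, hu, by simp⟩
    · rintro ⟨w, hw, hwa⟩
      refine ⟨g⁻¹ * w, by simpa using hw, ?_⟩
      rw [Units.val_mul, hwa]
      simp
  have hdet : LinearMap.det (LinearMap.mulLeft ℝ (g : R)) = Algebra.norm ℝ (g : R) := rfl
  rw [h, Measure.addHaar_preimage_linearMap μ (by rw [hdet]; exact algebraNorm_unit_ne_zero g),
    hdet, abs_inv, smul_eq_mul]

instance (μ : Measure R) [μ.IsAddHaarMeasure] : (unitsMeasure μ).IsMulLeftInvariant where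
  map_mul_left_eq_self g := by
    refine Measure.ext_of_lintegral _ fun f hf => ?_
    have hd : Measurable fun u : Rˣ => ENNReal.ofReal |Algebra.norm ℝ (u : R)|⁻¹ :=
      continuous_density.measurable.ennreal_ofReal
    have hpos : 0 < |Algebra.norm ℝ (g : R)| := abs_pos.2 (algebraNorm_unit_ne_zero g)
    rw [lintegral_map hf (measurable_mul_left_units g),
      lintegral_unitsMeasure μ (fun u => f (g * u)) (hf.comp (measurable_mul_left_units g)),
      lintegral_unitsMeasure μ _ hf]
    have h : ∀ u : Rˣ, ENNReal.ofReal |Algebra.norm ℝ (u : R)|⁻¹ * f (g * u) =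
        ENNReal.ofReal |Algebra.norm ℝ (g : R)| *
          (ENNReal.ofReal |Algebra.norm ℝ ((g * u : Rˣ) : R)|⁻¹ * f (g * u)) := by
      intro u
      rw [← mul_assoc, ← ENNReal.ofReal_mul (abs_nonneg _), Units.val_mul, map_mul, abs_mul,
        mul_inv, mul_inv_cancel_left₀ hpos.ne']
    have hF : Measurable fun u : Rˣ => ENNReal.ofReal |Algebra.norm ℝ (u : R)|⁻¹ * f u :=
      hd.mul hf
    have hFg : Measurable fun u : Rˣ =>
        ENNReal.ofReal |Algebra.norm ℝ ((g * u : Rˣ) : R)|⁻¹ * f (g * u) :=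
      hF.comp (measurable_mul_left_units g)
    have hmap := lintegral_map (μ := μ.comap Units.val) hF (measurable_mul_left_units g)
    simp_rw [h]
    rw [lintegral_const_mul _ hFg, ← hmap,
      map_mul_left_comap_unitsVal, lintegral_smul_measure, smul_eq_mul, ← mul_assoc,
      ← ENNReal.ofReal_mul (abs_nonneg _), mul_inv_cancel₀ hpos.ne', ENNReal.ofReal_one, one_mul]

instance (μ : Measure R) [μ.IsAddHaarMeasure] : IsFiniteMeasureOnCompacts (unitsMeasure μ) := by
  have : IsFiniteMeasureOnCompacts (μ.comap (Units.val : Rˣ → R)) := by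
    refine ⟨fun K hK => ?_⟩
    rw [measurableEmbedding_unitsVal.comap_apply]
    exact (hK.image Units.continuous_val).measure_lt_top
  have := locallyCompactSpace_units (R := R)
  have : IsLocallyFiniteMeasure (μ.comap (Units.val : Rˣ → R)) :=
    isLocallyFiniteMeasure_of_isFiniteMeasureOnCompacts
  have : IsLocallyFiniteMeasure (unitsMeasure μ) :=
    IsLocallyFiniteMeasure.withDensity_ofReal continuous_density
  infer_instance

lemma unitsMeasure_ne_zero (μ : Measure R) [μ.IsAddHaarMeasure] : unitsMeasure μ ≠ 0 := by
  intro h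
  rw [unitsMeasure, withDensity_eq_zero_iff
    continuous_density.measurable.ennreal_ofReal.aemeasurable] at h
  have h2 : ∀ᵐ u ∂(μ.comap (Units.val : Rˣ → R)), False := by
    filter_upwards [h] with u hu
    have hpos : 0 < |Algebra.norm ℝ (u : R)| := abs_pos.2 (algebraNorm_unit_ne_zero u)
    simp only [Pi.zero_apply, ENNReal.ofReal_eq_zero, inv_nonpos] at hu
    exact absurd hu (not_le.2 hpos)
  rw [ae_iff] at h2
  simp only [not_false_eq_true, Set.ofPred_true, measurableEmbedding_unitsVal.comap_apply,
    Set.image_univ] at h2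
  exact (isOpenEmbedding_unitsVal (R := R)).isOpen_range.measure_ne_zero μ
    (Set.range_nonempty _) h2

/-- Integrability over the group of units of a finite-dimensional real algebra reduces to
integrability over the algebra. -/
lemma integrable_units_of_integrable (μ : Measure R) [μ.IsAddHaarMeasure] (ν : Measure Rˣ)
    [ν.IsHaarMeasure] {f : R → ℝ} (hf : Integrable f μ) :
    Integrable (fun u : Rˣ => f u * |Algebra.norm ℝ (u : R)|) ν := by
  have : ProperSpace R := FiniteDimensional.proper ℝ R
  have := locallyCompactSpace_units (R := R)
  have : SecondCountableTopology Rˣ :=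
    (isOpenEmbedding_unitsVal (R := R)).isEmbedding.secondCountableTopology
  -- Uniqueness of Haar measure; `c ≠ 0` because `unitsMeasure μ` is nonzero.
  obtain ⟨c, key⟩ : ∃ c : NNReal, unitsMeasure μ = (c : ENNReal) • ν :=
    ⟨_, Measure.isMulLeftInvariant_eq_smul (unitsMeasure μ) ν⟩
  have h1 : Integrable (fun u : Rˣ => f u * |Algebra.norm ℝ (u : R)|) (unitsMeasure μ) := by
    rw [unitsMeasure, integrable_withDensity_iff_integrable_smul'
      continuous_density.measurable.ennreal_ofReal (by simp)]
    have h2 : Integrable (f ∘ Units.val) (μ.comap (Units.val : Rˣ → R)) := by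
      rw [← measurableEmbedding_unitsVal.integrable_map_iff,
        measurableEmbedding_unitsVal.map_comap]
      exact hf.integrableOn
    refine h2.congr (Eventually.of_forall fun u => ?_)
    have hpos : 0 < |Algebra.norm ℝ (u : R)| := abs_pos.2 (algebraNorm_unit_ne_zero u)
    simp only [Function.comp_apply, smul_eq_mul, ENNReal.toReal_ofReal (inv_nonneg.2 hpos.le)]
    field_simp
  rw [key] at h1
  refine (integrable_smul_measure (fun h0 => ?_) ENNReal.coe_ne_top).1 h1
  exact unitsMeasure_ne_zero μ (by rw [key, h0, zero_smul])

omit [MeasurableSpace R] [BorelSpace R] in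
lemma integrable_units_of_norm_le (ν : Measure Rˣ) [ν.IsHaarMeasure] {S : R → ℝ}
    (hSc : Continuous S) (hS0 : ∀ a, 0 ≤ S a) {c : ℝ} (hS : ∀ a, 1 + ‖a‖ ≤ c * (1 + S a)) {k : ℕ}
    (hk : Module.finrank ℝ R < k) :
    Integrable (fun u : Rˣ => ((1 + S u) ^ k)⁻¹ * |Algebra.norm ℝ (u : R)|) ν := by
  borelize R
  refine integrable_units_of_integrable (Measure.addHaar : Measure R) ν
    (f := fun a => ((1 + S a) ^ k)⁻¹) ?_
  have h : Integrable (fun a : R => (1 + ‖a‖) ^ (-(k : ℝ))) Measure.addHaar :=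
    integrable_one_add_norm (by exact_mod_cast hk)
  have hpos : ∀ a, 0 < 1 + S a := fun a => by linarith [hS0 a]
  refine (h.const_mul (c ^ k)).mono' ?_ (Eventually.of_forall fun a => ?_)
  · exact (((continuous_const.add hSc).pow k).inv₀
      fun a => (pow_pos (hpos a) k).ne').aestronglyMeasurable
  · have ha : 0 < 1 + ‖a‖ := by positivity
    rw [Real.norm_of_nonneg (inv_nonneg.2 (pow_pos (hpos a) k).le), Real.rpow_neg ha.le,
      Real.rpow_natCast, ← div_eq_mul_inv, inv_eq_one_div,
      div_le_div_iff₀ (pow_pos (hpos a) k) (pow_pos ha k), one_mul, ← mul_pow]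
    exact pow_le_pow_left₀ ha.le (hS a) k

end UnitsHaar

/-! ### Polynomial estimates for matrices and the dominating function. -/

section MatrixBounds

variable {F : Type*} [RCLike F] {n : ℕ}

/-- The sum of the squares of the absolute values of the entries of a matrix. -/
noncomputable def sqNorm (A : Matrix (Fin n) (Fin n) F) : ℝ := ∑ i, ∑ j, ‖A i j‖ ^ 2

lemma sqNorm_nonneg (A : Matrix (Fin n) (Fin n) F) : 0 ≤ sqNorm A :=
  Finset.sum_nonneg fun _ _ => Finset.sum_nonneg fun _ _ => sq_nonneg _

lemma one_le_one_add_sqNorm (A : Matrix (Fin n) (Fin n) F) : 1 ≤ 1 + sqNorm A :=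
  le_add_of_nonneg_right (sqNorm_nonneg A)

lemma norm_entry_le (A : Matrix (Fin n) (Fin n) F) (i j : Fin n) : ‖A i j‖ ≤ 1 + sqNorm A := by
  have h1 : ‖A i j‖ ^ 2 ≤ sqNorm A :=
    (Finset.single_le_sum (f := fun j => ‖A i j‖ ^ 2) (fun _ _ => sq_nonneg _)
      (Finset.mem_univ j)).trans
      (Finset.single_le_sum (f := fun i => ∑ j, ‖A i j‖ ^ 2)
        (fun _ _ => Finset.sum_nonneg fun _ _ => sq_nonneg _) (Finset.mem_univ i))
  nlinarith [sq_nonneg (‖A i j‖ - 1)]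

lemma norm_det_le_of_entry_le {A : Matrix (Fin n) (Fin n) F} {x : ℝ} (h : ∀ i j, ‖A i j‖ ≤ x) :
    ‖A.det‖ ≤ n.factorial * x ^ n := by
  have := Matrix.det_le (abv := (NormedField.toAbsoluteValue F)) (A := A) (x := x) h
  simpa [NormedField.toAbsoluteValue] using this

lemma norm_det_le (A : Matrix (Fin n) (Fin n) F) :
    ‖A.det‖ ≤ n.factorial * (1 + sqNorm A) ^ n :=
  norm_det_le_of_entry_le (norm_entry_le A)

/-- A cofactor is the determinant of `A` with one row replaced by a basis vector, and its entries
still obey the bound `1 + sqNorm A`. -/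
lemma sqNorm_adjugate_le (A : Matrix (Fin n) (Fin n) F) :
    sqNorm A.adjugate ≤ n ^ 2 * (n.factorial * (1 + sqNorm A) ^ n) ^ 2 := by
  have h : ∀ i j, ‖A.adjugate i j‖ ≤ n.factorial * (1 + sqNorm A) ^ n := by
    intro i j
    rw [Matrix.adjugate_apply]
    refine norm_det_le_of_entry_le fun a b => ?_
    rw [Matrix.updateRow_apply]
    split_ifs
    · rw [Pi.single_apply]
      split_ifs
      · simpa using sqNorm_nonneg A
      · simpa using zero_le_one.trans (one_le_one_add_sqNorm A)
    · exact norm_entry_le A a b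
  calc sqNorm A.adjugate ≤ ∑ _i : Fin n, ∑ _j : Fin n, (n.factorial * (1 + sqNorm A) ^ n) ^ 2 :=
        Finset.sum_le_sum fun i _ => Finset.sum_le_sum fun j _ => by gcongr; exact h i j
    _ = _ := by simp; ring

lemma norm_det_sq_mul_sqNorm_inv_le (g : GL (Fin n) F) :
    ‖(g : Matrix (Fin n) (Fin n) F).det‖ ^ 2 * sqNorm ((g⁻¹ : GL (Fin n) F) : Matrix (Fin n) (Fin n) F) ≤
      n ^ 2 * (n.factorial * (1 + sqNorm (g : Matrix (Fin n) (Fin n) F)) ^ n) ^ 2 := by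
  refine le_trans (le_of_eq ?_) (sqNorm_adjugate_le _)
  have hd : (g : Matrix (Fin n) (Fin n) F).det ≠ 0 :=
    ((Matrix.isUnit_iff_isUnit_det _).1 g.isUnit).ne_zero
  have h : (g : Matrix (Fin n) (Fin n) F).adjugate =
      (g : Matrix (Fin n) (Fin n) F).det • ((g⁻¹ : GL (Fin n) F) : Matrix (Fin n) (Fin n) F) := by
    rw [Matrix.coe_units_inv, Matrix.inv_def, smul_smul, Ring.inverse_eq_inv',
      mul_inv_cancel₀ hd, one_smul]
  rw [h]
  simp [sqNorm, Finset.mul_sum, mul_pow]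

lemma groupNorm_nu (g : GL (Fin n) F) :
    groupNorm (nu g) = sqNorm (g : Matrix (Fin n) (Fin n) F) +
      sqNorm ((g⁻¹ : GL (Fin n) F) : Matrix (Fin n) (Fin n) F) + 2 * n := by
  have h1 : ((nu g : GL (Fin n ⊕ Fin n) F) :
      Matrix (Fin n ⊕ Fin n) (Fin n ⊕ Fin n) F) =
      Matrix.fromBlocks (g : Matrix (Fin n) (Fin n) F) 0 0 1 := by
    simp [nu, blockUpper]
  have h2 : (((nu g)⁻¹ : GL (Fin n ⊕ Fin n) F) :
      Matrix (Fin n ⊕ Fin n) (Fin n ⊕ Fin n) F) =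
      Matrix.fromBlocks ((g⁻¹ : GL (Fin n) F) : Matrix (Fin n) (Fin n) F) 0 0 1 := by
    change Matrix.fromBlocks _ _ _ _ = _
    simp
  have h3 : ∀ i j : Fin n, ‖(1 : Matrix (Fin n) (Fin n) F) i j‖ ^ 2 = if i = j then 1 else 0 := by
    intro i j
    rw [Matrix.one_apply]
    split_ifs <;> simp
  simp only [groupNorm, h1, h2, Fintype.sum_sum_type, Matrix.fromBlocks_apply₁₁,
    Matrix.fromBlocks_apply₁₂, Matrix.fromBlocks_apply₂₁, Matrix.fromBlocks_apply₂₂, h3]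
  simp [sqNorm]
  ring

/-- Since `g⁻¹` is the adjugate over the determinant, `|det g|²` clears the pole of `groupNorm (nu
g)`. -/
lemma groupNorm_nu_mul_norm_det_sq_le (g : GL (Fin n) F) :
    groupNorm (nu g) * ‖(g : Matrix (Fin n) (Fin n) F).det‖ ^ 2 ≤
      ((2 * n + 1 + n ^ 2) * (n.factorial : ℝ) ^ 2) *
        (1 + sqNorm (g : Matrix (Fin n) (Fin n) F)) ^ (2 * n + 1) := by
  have h1 := norm_det_sq_mul_sqNorm_inv_le g
  have h2 := norm_det_le (g : Matrix (Fin n) (Fin n) F)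
  rw [groupNorm_nu]
  set S := sqNorm (g : Matrix (Fin n) (Fin n) F)
  set w := ‖(g : Matrix (Fin n) (Fin n) F).det‖
  have hS : 0 ≤ S := sqNorm_nonneg _
  have hX : 0 ≤ (n.factorial * (1 + S) ^ n) ^ 2 := sq_nonneg _
  have h3 : w ^ 2 ≤ (n.factorial * (1 + S) ^ n) ^ 2 := by gcongr
  have h4 : (S + 2 * n) * w ^ 2 ≤ (2 * n + 1) * (1 + S) * (n.factorial * (1 + S) ^ n) ^ 2 := by
    gcongr
    have : (0 : ℝ) ≤ n := n.cast_nonneg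
    nlinarith
  have h5 : (n : ℝ) ^ 2 * (n.factorial * (1 + S) ^ n) ^ 2 ≤
      n ^ 2 * (1 + S) * (n.factorial * (1 + S) ^ n) ^ 2 := by
    gcongr
    exact le_mul_of_one_le_right (sq_nonneg _) (by linarith)
  calc _ = (S + 2 * n) * w ^ 2 + w ^ 2 * sqNorm ((g⁻¹ : GL (Fin n) F) : Matrix (Fin n) (Fin n) F) := by ring
    _ ≤ _ := add_le_add h4 (h1.trans h5)
    _ = _ := by ring

/-- Conjugation preserves the norm, so its square is the norm of the real scalar `‖c‖²`; this treats
`ℝ` and `ℂ` at once. -/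
lemma abs_algebraNorm_rclike (c : F) : |Algebra.norm ℝ c| = ‖c‖ ^ Module.finrank ℝ F := by
  have h1 : Algebra.norm ℝ ((starRingEnd F) c) = Algebra.norm ℝ c := by
    simpa using Algebra.norm_eq_of_algEquiv (RCLike.conjAe (K := F)) c
  have h2 : Algebra.norm ℝ c ^ 2 = (‖c‖ ^ Module.finrank ℝ F) ^ 2 := by
    rw [sq]
    nth_rewrite 2 [← h1]
    rw [← map_mul, RCLike.mul_conj, ← RCLike.algebraMap_eq_ofReal, ← map_pow,
      Algebra.norm_algebraMap, ← pow_mul, ← pow_mul, mul_comm]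
  rw [← abs_of_nonneg (pow_nonneg (norm_nonneg c) _)]
  exact (sq_eq_sq_iff_abs_eq_abs _ _).1 h2

/-- Left multiplication acts on each of the `n` columns by `A`; the transpose in `e` makes the
columns the outer index. -/
lemma det_mulLeft_matrix (A : Matrix (Fin n) (Fin n) F) :
    LinearMap.det (LinearMap.mulLeft F A) = A.det ^ n := by
  let e : Matrix (Fin n) (Fin n) F ≃ₗ[F] (Fin n → Fin n → F) :=
    (Matrix.transposeLinearEquiv (Fin n) (Fin n) F F).trans (Matrix.ofLinearEquiv F).symm
  have h : (e.toLinearMap ∘ₗ LinearMap.mulLeft F A ∘ₗ e.symm.toLinearMap) =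
      (LinearMap.pi fun i => (Matrix.toLin' A) ∘ₗ LinearMap.proj i) := by
    refine LinearMap.ext fun B => ?_
    funext i j
    rfl
  rw [← LinearMap.det_conj (LinearMap.mulLeft F A) e, h, LinearMap.det_pi]
  simp

lemma abs_algebraNorm_matrix (A : Matrix (Fin n) (Fin n) F) :
    |Algebra.norm ℝ A| = ‖A.det‖ ^ (Module.finrank ℝ F * n) := by
  have h : Algebra.norm ℝ A = Algebra.norm ℝ (A.det ^ n) := by
    rw [← det_mulLeft_matrix, ← LinearMap.det_restrictScalars]
    rfl
  rw [h, abs_algebraNorm_rclike, norm_pow, ← pow_mul, mul_comm]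

section Integrability

attribute [local instance] Matrix.linftyOpNormedRing Matrix.linftyOpNormedAlgebra

lemma one_add_linfty_opNorm_le (A : Matrix (Fin n) (Fin n) F) :
    1 + ‖A‖ ≤ (n + 1) * (1 + sqNorm A) := by
  have hS := sqNorm_nonneg A
  have h : ‖A‖ ≤ n * (1 + sqNorm A) := by
    rw [Matrix.linfty_opNorm_def]
    have h0 : (0 : ℝ) ≤ n * (1 + sqNorm A) := by positivity
    rw [← NNReal.coe_mk _ h0, NNReal.coe_le_coe]
    refine Finset.sup_le fun i _ => ?_
    rw [← NNReal.coe_le_coe]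
    push_cast
    calc ∑ j, ‖A i j‖ ≤ ∑ _j : Fin n, (1 + sqNorm A) :=
          Finset.sum_le_sum fun j _ => norm_entry_le A i j
      _ = _ := by simp only [Finset.sum_const, Finset.card_univ, Fintype.card_fin, nsmul_eq_mul]
  linarith

lemma continuous_sqNorm : Continuous (sqNorm : Matrix (Fin n) (Fin n) F → ℝ) :=
  continuous_finsetSum _ fun i _ => continuous_finsetSum _ fun j _ =>
    ((continuous_id.matrix_elem i j).norm.pow 2)

lemma integrable_sqNorm_pow_inv_mul_norm_det [MeasurableSpace (GL (Fin n) F)]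
    [hB : BorelSpace (GL (Fin n) F)] (dg : Measure (GL (Fin n) F)) [hdg : dg.IsHaarMeasure] {k : ℕ}
    (hk : Module.finrank ℝ (Matrix (Fin n) (Fin n) F) < k) :
    Integrable (fun g : GL (Fin n) F => ((1 + sqNorm (g : Matrix (Fin n) (Fin n) F)) ^ k)⁻¹ *
      ‖(g : Matrix (Fin n) (Fin n) F).det‖ ^ (Module.finrank ℝ F * n)) dg := by
  simp_rw [← abs_algebraNorm_matrix]
  exact @integrable_units_of_norm_le (Matrix (Fin n) (Fin n) F) _ _ inferInstance _ hB dg hdg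
    sqNorm continuous_sqNorm sqNorm_nonneg _ one_add_linfty_opNorm_le _ hk

end Integrability

open Module in
/-- Polynomial growth on the image of `nu` is compensated by a high power of the determinant and
a negative power of `1 + sqNorm g`. -/
lemma exists_integrable_dominating [MeasurableSpace (GL (Fin n) F)]
    [BorelSpace (GL (Fin n) F)] (dg : Measure (GL (Fin n) F)) [dg.IsHaarMeasure]
    (N : ℕ) (σ : ℝ) (hσ : 2 * N + n + 1 < σ) :
    ∃ (K : ℕ) (Φ : GL (Fin n) F → ℝ), Integrable Φ dg ∧ ∀ g : GL (Fin n) F,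
      groupNorm (nu g) ^ N * nabs (g : Matrix (Fin n) (Fin n) F).det ^ (σ - 1 / 2) ≤
        (1 + sqNorm (g : Matrix (Fin n) (Fin n) F)) ^ K * Φ g := by
  set d := finrank ℝ F with hd
  have hd1 : (1 : ℝ) ≤ d := by
    exact_mod_cast Nat.one_le_iff_ne_zero.2 (finrank_pos (R := ℝ) (M := F)).ne'
  -- The exponent of `‖det g‖` left over once `2N` has cleared the pole of `groupNorm ^ N` and `d *
  -- n` has paid for the Haar density. The lower bound on `σ` makes it nonnegative.
  set e : ℝ := d * (σ - 1 / 2) - 2 * N - d * n with he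
  have he0 : 0 ≤ e := by
    have : (σ - 1 / 2 - n) ≤ d * (σ - 1 / 2 - n) :=
      le_mul_of_one_le_left (by nlinarith [(N.cast_nonneg : (0 : ℝ) ≤ N)]) hd1
    rw [he]
    nlinarith
  obtain ⟨q, hq⟩ := exists_nat_ge e
  set r := finrank ℝ (Matrix (Fin n) (Fin n) F) + 1 with hr
  have hΦ := integrable_sqNorm_pow_inv_mul_norm_det dg (F := F) (n := n) (k := r) (by omega)
  rw [← hd] at hΦ
  set C : ℝ := (2 * n + 1 + n ^ 2) * (n.factorial : ℝ) ^ 2 with hC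
  -- The three summands come from the cleared pole, from the leftover determinant power `e ≤ q`, and
  -- from integrability over the matrix space.
  refine ⟨(2 * n + 1) * N + n * q + r, _, hΦ.const_mul (C ^ N * (n.factorial : ℝ) ^ q),
    fun g => ?_⟩
  have h1 := groupNorm_nu_mul_norm_det_sq_le g
  have h2 := norm_det_le (g : Matrix (Fin n) (Fin n) F)
  have h0 := one_le_one_add_sqNorm (g : Matrix (Fin n) (Fin n) F)
  have hw : 0 < ‖(g : Matrix (Fin n) (Fin n) F).det‖ :=
    norm_pos_iff.2 ((Matrix.isUnit_iff_isUnit_det _).1 g.isUnit).ne_zero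
  have hG : 0 ≤ groupNorm (nu g) := by
    unfold groupNorm
    positivity
  rw [nabs]
  set T := 1 + sqNorm (g : Matrix (Fin n) (Fin n) F)
  set w := ‖(g : Matrix (Fin n) (Fin n) F).det‖
  have hT : 0 < T := zero_lt_one.trans_le h0
  have hf : (1 : ℝ) ≤ n.factorial := by exact_mod_cast n.factorial_pos
  have hsplit : (w ^ d) ^ (σ - 1 / 2) = (w ^ 2) ^ N * w ^ (d * n) * w ^ e := by
    rw [← pow_mul, ← pow_add, ← Real.rpow_natCast w d, ← Real.rpow_mul hw.le,
      ← Real.rpow_natCast, ← Real.rpow_add hw, he]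
    congr 1
    push_cast
    ring
  have hwe : w ^ e ≤ (n.factorial : ℝ) ^ q * T ^ (n * q) := by
    calc w ^ e ≤ (n.factorial * T ^ n) ^ e := Real.rpow_le_rpow hw.le h2 he0
      _ ≤ (n.factorial * T ^ n) ^ (q : ℝ) :=
        Real.rpow_le_rpow_of_exponent_le (one_le_mul_of_one_le_of_one_le hf (one_le_pow₀ h0)) hq
      _ = _ := by rw [Real.rpow_natCast, mul_pow, ← pow_mul]
  have hGN : groupNorm (nu g) ^ N * (w ^ 2) ^ N ≤ C ^ N * T ^ ((2 * n + 1) * N) := by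
    rw [← mul_pow, pow_mul, ← mul_pow]
    exact pow_le_pow_left₀ (by positivity) h1 N
  calc groupNorm (nu g) ^ N * (w ^ d) ^ (σ - 1 / 2)
      = (groupNorm (nu g) ^ N * (w ^ 2) ^ N) * w ^ e * w ^ (d * n) := by rw [hsplit]; ring
    _ ≤ (C ^ N * T ^ ((2 * n + 1) * N)) * ((n.factorial : ℝ) ^ q * T ^ (n * q)) * w ^ (d * n) := by
      gcongr
    _ = _ := by
      rw [pow_add, pow_add]
      field_simp

end MatrixBounds

/-! ### Block matrix identities and scalar dilations. -/

section BlockMatrices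

variable {F : Type*} [RCLike F] {n : ℕ}

lemma nu_mul_blockUpper (g : GL (Fin n) F) (A : Matrix (Fin n) (Fin n) F) :
    nu g * blockUpper 1 1 A = blockUpper 1 1 ((g : Matrix (Fin n) (Fin n) F) * A) * nu g := by
  ext1
  simp [nu, blockUpper, Matrix.fromBlocks_multiply]

lemma nu_mul (g h : GL (Fin n) F) : nu (g * h) = nu g * nu h := by
  ext1
  simp [nu, blockUpper, Matrix.fromBlocks_multiply]

lemma continuous_nu : Continuous (nu : GL (Fin n) F → GL (Fin n ⊕ Fin n) F) := by
  rw [Units.continuous_iff]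
  constructor
  · exact Continuous.matrix_fromBlocks Units.continuous_val continuous_const continuous_const
      continuous_const
  · have h : ∀ g : GL (Fin n) F, (((nu g)⁻¹ : GL (Fin n ⊕ Fin n) F) :
      Matrix (Fin n ⊕ Fin n) (Fin n ⊕ Fin n) F) =
        Matrix.fromBlocks ((g⁻¹ : GL (Fin n) F) : Matrix (Fin n) (Fin n) F) 0 0 1 := by
      intro g
      change Matrix.fromBlocks _ _ _ _ = _
      simp
    simp_rw [h]
    exact Continuous.matrix_fromBlocks (Units.continuous_val.comp continuous_inv)
      continuous_const continuous_const continuous_const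

lemma blockUpper_one_one_smul (X : Matrix (Fin n) (Fin n) F) (t : ℝ) :
    ((blockUpper 1 1 (t • X) : GL (Fin n ⊕ Fin n) F) :
      Matrix (Fin n ⊕ Fin n) (Fin n ⊕ Fin n) F) =
      1 + t • Matrix.fromBlocks 0 X 0 0 := by
  rw [← Matrix.fromBlocks_one, Matrix.fromBlocks_smul, Matrix.fromBlocks_add]
  simp [blockUpper]

/-- The scalar matrix `1 + t`, as an element of `GL_n(F)` whenever `1 + t ≠ 0`. -/
noncomputable def dilation (F : Type*) [RCLike F] (n : ℕ) (t : ℝ) : GL (Fin n) F :=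
  if h : 1 + t ≠ 0 then
    Units.map (algebraMap ℝ (Matrix (Fin n) (Fin n) F)).toMonoidHom (Units.mk0 (1 + t) h)
  else 1

lemma dilation_val {t : ℝ} (h : 1 + t ≠ 0) :
    (dilation F n t : Matrix (Fin n) (Fin n) F) = (1 + t) • (1 : Matrix (Fin n) (Fin n) F) := by
  rw [dilation, dif_pos h]
  simp [Algebra.algebraMap_eq_smul_one]

lemma dilation_mul_comm {t : ℝ} (h : 1 + t ≠ 0) (g : GL (Fin n) F) :
    g * dilation F n t = dilation F n t * g := by
  ext1
  simp [dilation_val h]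

lemma nu_dilation_val {t : ℝ} (h : 1 + t ≠ 0) :
    (nu (dilation F n t) : Matrix (Fin n ⊕ Fin n) (Fin n ⊕ Fin n) F) =
      1 + t • Matrix.fromBlocks 1 0 0 0 := by
  rw [← Matrix.fromBlocks_one, Matrix.fromBlocks_smul, Matrix.fromBlocks_add]
  simp [blockUpper, nu, dilation_val h, add_smul]

lemma nabs_mul (x y : F) : nabs (x * y) = nabs x * nabs y := by
  simp [nabs, mul_pow]

lemma nabs_det_pos (g : GL (Fin n) F) : 0 < nabs (g : Matrix (Fin n) (Fin n) F).det :=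
  pow_pos (norm_pos_iff.2 ((Matrix.isUnit_iff_isUnit_det _).1 g.isUnit).ne_zero) _

lemma nabs_det_dilation {t : ℝ} (h : 0 < 1 + t) :
    nabs (dilation F n t : Matrix (Fin n) (Fin n) F).det = (1 + t) ^ (n * Module.finrank ℝ F) := by
  have hs : (1 + t) • (1 : Matrix (Fin n) (Fin n) F) = ((1 + t : ℝ) : F) • 1 := by
    ext i j
    simp [RCLike.real_smul_eq_coe_mul]
  rw [nabs, dilation_val h.ne', hs, Matrix.det_smul, Matrix.det_one, mul_one, Fintype.card_fin,
    norm_pow, RCLike.norm_ofReal, abs_of_pos h, ← pow_mul]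

/-- The two traces pick out the real part and, up to sign, the imaginary part of `A i j`. For `F =
ℝ`, `RCLike.I` is `0` and the second vanishes. -/
lemma sum_re_trace_sq (A : Matrix (Fin n) (Fin n) F) :
    ∑ i, ∑ j, (RCLike.re (A * Matrix.single j i (1 : F)).trace ^ 2 +
      RCLike.re (A * Matrix.single j i (RCLike.I : F)).trace ^ 2) = sqNorm A := by
  refine Finset.sum_congr rfl fun i _ => Finset.sum_congr rfl fun j _ => ?_
  rw [Matrix.trace_mul_single, Matrix.trace_mul_single, RCLike.norm_sq_eq_def]
  simp [RCLike.mul_re]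
  ring

end BlockMatrices

/-! ### Differentiating the representation at the identity. -/

section Derivative

variable {F : Type*} [RCLike F] {m : Type*} [Fintype m] [DecidableEq m]
  {V : Type*} [AddCommGroup V] [Module ℂ V] [UniformSpace V] [IsUniformAddGroup V]
  [ContinuousSMul ℂ V] [LocallyConvexSpace ℝ V] [T2Space V] [FirstCountableTopology V]
  [CompleteSpace V]

open scoped ComplexOrder in
omit [IsUniformAddGroup V] [ContinuousSMul ℂ V] [T2Space V] [FirstCountableTopology V]
  [CompleteSpace V] in
lemma locallyConvexSpace_complex : LocallyConvexSpace ℂ V :=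
  ⟨fun x => (LocallyConvexSpace.convex_basis (𝕜 := ℝ) x).to_hasBasis
    (fun s hs => ⟨s, ⟨hs.1, convex_of_nonneg_surjective_algebraMap _
      (fun _ hz => RCLike.nonneg_iff_exists_ofReal.mp (Set.mem_Ici.1 hz)) hs.2⟩, subset_rfl⟩)
    (fun s hs => ⟨s, ⟨hs.1, hs.2.lift ℝ⟩, subset_rfl⟩)⟩

lemma orbitMap_val (π : GL m F →* (V →L[ℂ] V)) (v : V) (g : GL m F) :
    orbitMap π v (g : Matrix m m F) = π g v :=
  Units.val_injective.extend_apply _ _ _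

/-- The derivative at `1` of a smooth representation on a Fréchet space along a straight line is a
continuous operator. -/
lemma exists_derivative {π : GL m F →* (V →L[ℂ] V)} (hπ : ∀ v, IsSmoothVector π v)
    {γ : ℝ → GL m F} {X : Matrix m m F}
    (hγ : ∀ᶠ t in 𝓝[≠] (0 : ℝ), (γ t : Matrix m m F) = 1 + t • X) :
    ∃ D : V →L[ℂ] V, ∀ v,
      Tendsto (fun t : ℝ => ((t⁻¹ : ℝ) : ℂ) • (π (γ t) v - v)) (𝓝[≠] 0) (𝓝 (D v)) := by
  have hex : ∀ v, ∃ w,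
      Tendsto (fun t : ℝ => ((t⁻¹ : ℝ) : ℂ) • (π (γ t) v - v)) (𝓝[≠] 0) (𝓝 w) := by
    intro v
    obtain ⟨-, f', hf', -⟩ := hπ v 1
    refine ⟨f' X 1, (hf' 1 isUnit_one X).congr' ?_⟩
    filter_upwards [hγ] with t ht
    rw [← ht, orbitMap_val, ← Units.val_one, orbitMap_val, map_one, Complex.coe_smul]
    rfl
  choose f hf using hex
  have : (uniformity V).IsCountablyGenerated := IsUniformAddGroup.uniformity_countably_generated
  have : ContinuousSMul ℝ V := IsScalarTower.continuousSMul ℂ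
  have := locallyConvexSpace_complex (V := V)
  -- Banach–Steinhaus: a pointwise limit of continuous operators on a Fréchet space is continuous.
  exact ⟨continuousLinearMapOfTendsto
    (fun t : ℝ => ((t⁻¹ : ℝ) : ℂ) • (π (γ t) - ContinuousLinearMap.id ℂ V))
    (tendsto_pi_nhds.2 hf), hf⟩

end Derivative

/-! ### Multiplication operators from the unipotent radical. -/

section Zeta

variable {F : Type*} [RCLike F] {n : ℕ}
  {V : Type*} [AddCommGroup V] [Module ℂ V] [UniformSpace V] [IsUniformAddGroup V]
  [ContinuousSMul ℂ V] [LocallyConvexSpace ℝ V] [T2Space V] [FirstCountableTopology V]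
  [CompleteSpace V]
  {π : GL (Fin n ⊕ Fin n) F →* (V →L[ℂ] V)} {ℓ : V →L[ℂ] ℂ}

/-- `nu g` normalizes the unipotent radical, so the unipotent factor can be moved to the left, where
`ℓ` is equivariant. -/
lemma shalika_unipotent (hℓ : IsShalikaFunctional π ℓ) (g : GL (Fin n) F)
    (A : Matrix (Fin n) (Fin n) F) (v : V) :
    ℓ (π (nu g) (π (blockUpper 1 1 A) v)) =
      Complex.exp (2 * Real.pi * Complex.I *
        (RCLike.re ((g : Matrix (Fin n) (Fin n) F) * A).trace : ℝ)) * ℓ (π (nu g) v) := by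
  have h := hℓ 1 ((g : Matrix (Fin n) (Fin n) F) * A) (π (nu g) v)
  rw [← mul_apply_eq_comp, ← map_mul, ← nu_mul_blockUpper, map_mul] at h
  simpa using h

/-- The derivative along the unipotent radical acts on Shalika functions by multiplication by a
linear form. -/
lemma exists_unipotent_derivative (hπ : ∀ v, IsSmoothVector π v) (hℓ : IsShalikaFunctional π ℓ)
    (X : Matrix (Fin n) (Fin n) F) :
    ∃ D : V →L[ℂ] V, ∀ (g : GL (Fin n) F) (v : V),
      ℓ (π (nu g) (D v)) = 2 * Real.pi * Complex.I *
        (RCLike.re ((g : Matrix (Fin n) (Fin n) F) * X).trace : ℝ) * ℓ (π (nu g) v) := by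
  obtain ⟨D, hD⟩ := exists_derivative hπ (γ := fun t => blockUpper 1 1 (t • X))
    (Eventually.of_forall (blockUpper_one_one_smul X))
  refine ⟨D, fun g v => ?_⟩
  set a : ℂ := 2 * Real.pi * Complex.I *
    (RCLike.re ((g : Matrix (Fin n) (Fin n) F) * X).trace : ℝ) with ha
  have h1 := (((ℓ.comp (π (nu g))).continuous.tendsto (D v)).comp (hD v))
  have hder : HasDerivAt (fun t : ℝ => Complex.exp (a * t)) a 0 := by
    have h : HasDerivAt (fun z : ℂ => Complex.exp (a * z)) a ((0 : ℝ) : ℂ) := by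
      simpa using ((hasDerivAt_id (0 : ℂ)).const_mul a).cexp
    exact h.comp_ofReal
  have h2 := (hasDerivAt_iff_tendsto_slope_zero.1 hder).mul_const (ℓ (π (nu g) v))
  refine tendsto_nhds_unique h1 (h2.congr fun t => ?_)
  have htr : a * t = 2 * Real.pi * Complex.I *
      (RCLike.re ((g : Matrix (Fin n) (Fin n) F) * (t • X)).trace : ℝ) := by
    rw [ha, Matrix.mul_smul, Matrix.trace_smul, RCLike.smul_re]
    push_cast
    ring
  simp only [Function.comp_apply, ContinuousLinearMap.comp_apply, map_smul, map_sub,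
    shalika_unipotent hℓ, zero_add, htr]
  simp
  ring

/-- There is a continuous operator acting on Shalika functions by multiplication by
`1 + sqNorm g`. -/
lemma exists_multiplier (hπ : ∀ v, IsSmoothVector π v) (hℓ : IsShalikaFunctional π ℓ) :
    ∃ D : V →L[ℂ] V, ∀ (g : GL (Fin n) F) (v : V),
      ℓ (π (nu g) (D v)) =
        (1 + sqNorm (g : Matrix (Fin n) (Fin n) F) : ℝ) * ℓ (π (nu g) v) := by
  choose D hD using exists_unipotent_derivative hπ hℓ
  -- A Laplacian: each `D X ^ 2` multiplies by `-4π² (Re Tr (gX))²`, and these squares sum to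
  -- `sqNorm g`.
  refine ⟨1 - ((4 * Real.pi ^ 2 : ℝ) : ℂ)⁻¹ • ∑ i, ∑ j, (D (Matrix.single j i 1) ^ 2 +
    D (Matrix.single j i RCLike.I) ^ 2), fun g v => ?_⟩
  have hpi : (Real.pi : ℂ) ≠ 0 := by exact_mod_cast Real.pi_ne_zero
  have hsq : ∀ X, ℓ (π (nu g) ((D X ^ 2) v)) = -(4 * Real.pi ^ 2) *
      ((RCLike.re ((g : Matrix (Fin n) (Fin n) F) * X).trace ^ 2 : ℝ) : ℂ) * ℓ (π (nu g) v) := by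
    intro X
    rw [pow_two, mul_apply_eq_comp, hD, hD]
    push_cast
    linear_combination (4 * (Real.pi : ℂ) ^ 2 *
      (RCLike.re ((g : Matrix (Fin n) (Fin n) F) * X).trace : ℂ) ^ 2 * ℓ (π (nu g) v)) *
        Complex.I_sq
  rw [← sum_re_trace_sq]
  simp only [_root_.sub_apply, one_apply_eq_self,
    _root_.smul_apply, _root_.sum_apply, _root_.add_apply,
    map_sub, map_smul, map_sum, map_add, hsq, smul_eq_mul]
  simp only [← add_mul, ← mul_add, ← Finset.mul_sum, ← Finset.sum_mul, ← Complex.ofReal_add,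
    ← Complex.ofReal_sum]
  push_cast
  field_simp
  ring

end Zeta

/-! ### Convergence, vertical line bounds and polynomial multipliers. -/

section Integral

variable {F : Type*} [RCLike F] {n : ℕ}
  {V : Type*} [AddCommGroup V] [Module ℂ V] [UniformSpace V] [IsUniformAddGroup V]
  [ContinuousSMul ℂ V] [LocallyConvexSpace ℝ V] [T2Space V] [FirstCountableTopology V]
  [CompleteSpace V]
  {π : GL (Fin n ⊕ Fin n) F →* (V →L[ℂ] V)} {ℓ : V →L[ℂ] ℂ}

lemma exists_pow_multiplier (hπ : ∀ v, IsSmoothVector π v) (hℓ : IsShalikaFunctional π ℓ) (k : ℕ) :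
    ∃ D : V →L[ℂ] V, ∀ (g : GL (Fin n) F) (v : V),
      ℓ (π (nu g) (D v)) =
        ((1 + sqNorm (g : Matrix (Fin n) (Fin n) F)) ^ k : ℝ) * ℓ (π (nu g) v) := by
  obtain ⟨D, hD⟩ := exists_multiplier hπ hℓ
  induction k with
  | zero => exact ⟨1, fun g v => by simp⟩
  | succ k ih =>
    obtain ⟨E, hE⟩ := ih
    refine ⟨D * E, fun g v => ?_⟩
    rw [mul_apply_eq_comp, hD, hE]
    push_cast
    ring

lemma norm_integrand (v : V) (s : ℂ) (g : GL (Fin n) F) :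
    ‖integrand π ℓ v s g‖ =
      ‖ℓ (π (nu g) v)‖ * nabs (g : Matrix (Fin n) (Fin n) F).det ^ (s.re - 1 / 2) := by
  rw [integrand, norm_mul, Complex.norm_cpow_eq_rpow_re_of_pos (nabs_det_pos g)]
  simp

lemma continuous_integrand (hc : Continuous fun x : GL (Fin n ⊕ Fin n) F × V => π x.1 x.2)
    (v : V) (s : ℂ) : Continuous (integrand π ℓ v s) := by
  have h1 : Continuous fun g : GL (Fin n) F => ℓ (π (nu g) v) :=
    ℓ.continuous.comp (hc.comp (continuous_nu.prodMk continuous_const))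
  have h2 : Continuous fun g : GL (Fin n) F =>
      ((nabs (g : Matrix (Fin n) (Fin n) F).det : ℝ) : ℂ) :=
    Complex.continuous_ofReal.comp ((Units.continuous_val.matrix_det).norm.pow _)
  exact h1.mul (h2.cpow continuous_const fun g => Complex.ofReal_mem_slitPlane.2 (nabs_det_pos g))

lemma integrand_add (v w : V) (s : ℂ) :
    integrand π ℓ (v + w) s = integrand π ℓ v s + integrand π ℓ w s := by
  ext g
  simp [integrand, add_mul]

lemma integrand_smul (c : ℂ) (v : V) (s : ℂ) :
    integrand π ℓ (c • v) s = c • integrand π ℓ v s := by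
  ext g
  simp [integrand, mul_assoc]

variable [MeasurableSpace (GL (Fin n) F)] [BorelSpace (GL (Fin n) F)]
  (dg : Measure (GL (Fin n) F)) [dg.IsHaarMeasure]

variable {dg} in
lemma L_add {v w : V} {s : ℂ} (hv : Integrable (integrand π ℓ v s) dg)
    (hw : Integrable (integrand π ℓ w s) dg) :
    L dg π ℓ (v + w) s = L dg π ℓ v s + L dg π ℓ w s := by
  rw [L, integrand_add]
  exact integral_add hv hw

lemma L_smul (c : ℂ) (v : V) (s : ℂ) : L dg π ℓ (c • v) s = c * L dg π ℓ v s := by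
  rw [L, integrand_smul]
  exact integral_smul c _

/-- The integral defining `L` converges absolutely in some right half plane, and on each vertical
line in it, it is bounded by a continuous seminorm. -/
lemma exists_abscissa (hπ : IsIrredAdmSmoothRep π) (hℓ : IsShalikaFunctional π ℓ) :
    ∃ M : ℝ, 0 < M ∧
      (∀ (v : V) (s : ℂ), M < s.re → Integrable (integrand π ℓ v s) dg) ∧
      ∀ σ : ℝ, M < σ → ∃ β : Seminorm ℂ V, Continuous β ∧
        ∀ (v : V) (s : ℂ), s.re = σ → ‖L dg π ℓ v s‖ ≤ β v := by
  obtain ⟨β, hβ, N, hN⟩ := hπ.moderateGrowth ((normSeminorm ℂ ℂ).comp ℓ.toLinearMap)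
    (continuous_norm.comp ℓ.continuous)
  have hdom : ∀ σ : ℝ, 2 * N + n + 1 < σ → ∃ (Φ : GL (Fin n) F → ℝ) (D : V →L[ℂ] V),
      Integrable Φ dg ∧ ∀ (v : V) (s : ℂ), s.re = σ → ∀ g,
        ‖integrand π ℓ v s g‖ ≤ β (D v) * Φ g := by
    intro σ hσ
    obtain ⟨K, Φ, hΦ, hle⟩ := exists_integrable_dominating dg N σ hσ
    obtain ⟨D, hD⟩ := exists_pow_multiplier hπ.smooth hℓ K
    refine ⟨Φ, D, hΦ, fun v s hs g => ?_⟩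
    have hT : 0 < (1 + sqNorm (g : Matrix (Fin n) (Fin n) F)) ^ K :=
      pow_pos (zero_lt_one.trans_le (one_le_one_add_sqNorm _)) _
    have h1 : (1 + sqNorm (g : Matrix (Fin n) (Fin n) F)) ^ K * ‖ℓ (π (nu g) v)‖ ≤
        β (D v) * groupNorm (nu g) ^ N := by
      -- Moderate growth is applied to `D v` instead of `v`, which gains the decay factor `(1 +
      -- sqNorm g) ^ (-K)`.
      have := hN (nu g) (D v)
      rwa [Seminorm.comp_apply, coe_normSeminorm, ContinuousLinearMap.coe_coe, hD, norm_mul,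
        Complex.norm_real, Real.norm_of_nonneg hT.le] at this
    rw [norm_integrand, hs, ← mul_le_mul_iff_right₀ hT, ← mul_assoc]
    have hr : 0 ≤ nabs (g : Matrix (Fin n) (Fin n) F).det ^ (σ - 1 / 2) :=
      Real.rpow_nonneg (nabs_det_pos g).le _
    calc _ ≤ β (D v) * groupNorm (nu g) ^ N *
          nabs (g : Matrix (Fin n) (Fin n) F).det ^ (σ - 1 / 2) := by gcongr
      _ = β (D v) * (groupNorm (nu g) ^ N *
          nabs (g : Matrix (Fin n) (Fin n) F).det ^ (σ - 1 / 2)) := by ring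
      _ ≤ _ := mul_le_mul_of_nonneg_left (hle g) (apply_nonneg _ _)
      _ = _ := by ring
  refine ⟨2 * N + n + 1, by positivity, fun v s hs => ?_, fun σ hσ => ?_⟩
  · obtain ⟨Φ, D, hΦ, hle⟩ := hdom s.re hs
    exact (hΦ.const_mul (β (D v))).mono'
      (continuous_integrand hπ.continuous_action v s).aestronglyMeasurable
      (Eventually.of_forall (hle v s rfl))
  · obtain ⟨Φ, D, hΦ, hle⟩ := hdom σ hσ
    refine ⟨‖∫ g, Φ g ∂dg‖₊ • β.comp D.toLinearMap, ?_, fun v s hs => ?_⟩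
    · exact (continuous_const.mul (hβ.comp D.continuous) :
        Continuous fun v => ‖∫ g, Φ g ∂dg‖ * β (D v))
    · calc ‖L dg π ℓ v s‖ ≤ ∫ g, β (D v) * Φ g ∂dg :=
            norm_integral_le_of_norm_le (hΦ.const_mul _) (Eventually.of_forall (hle v s hs))
        _ = (∫ g, Φ g ∂dg) * β (D v) := by rw [integral_const_mul, mul_comm]
        _ ≤ ‖∫ g, Φ g ∂dg‖ * β (D v) :=
            mul_le_mul_of_nonneg_right (Real.le_norm_self _) (apply_nonneg _ _)

/-- Scalars are central in `GL (Fin n) F`, so the right translate is a left one, which the left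
invariance of `dg` removes. -/
lemma L_dilation (v : V) (s : ℂ) {t : ℝ} (ht : 0 < 1 + t) :
    L dg π ℓ (π (nu (dilation F n t)) v) s =
      (((1 + t) ^ (n * Module.finrank ℝ F) : ℝ) : ℂ) ^ (1 / 2 - s) * L dg π ℓ v s := by
  have h : ∀ g : GL (Fin n) F, integrand π ℓ (π (nu (dilation F n t)) v) s g =
      (((1 + t) ^ (n * Module.finrank ℝ F) : ℝ) : ℂ) ^ (1 / 2 - s) *
        integrand π ℓ v s (dilation F n t * g) := by
    intro g
    have hp : 0 < (1 + t) ^ (n * Module.finrank ℝ F) := pow_pos ht _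
    have hp' : (((1 + t) ^ (n * Module.finrank ℝ F) : ℝ) : ℂ) ≠ 0 := by exact_mod_cast hp.ne'
    rw [integrand, integrand, ← mul_apply_eq_comp, ← map_mul, ← nu_mul,
      dilation_mul_comm ht.ne', Units.val_mul, Matrix.det_mul, nabs_mul, nabs_det_dilation ht,
      Complex.ofReal_mul, Complex.mul_cpow_ofReal_nonneg hp.le (nabs_det_pos g).le]
    have : (((1 + t) ^ (n * Module.finrank ℝ F) : ℝ) : ℂ) ^ (1 / 2 - s) *
        (((1 + t) ^ (n * Module.finrank ℝ F) : ℝ) : ℂ) ^ (s - 1 / 2) = 1 := by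
      rw [← Complex.cpow_add _ _ hp']
      simp
    linear_combination (-(ℓ (π (nu (dilation F n t * g)) v) *
      (nabs (g : Matrix (Fin n) (Fin n) F).det : ℂ) ^ (s - 1 / 2))) * this
  rw [L, L]
  simp_rw [h]
  rw [integral_const_mul, integral_mul_left_eq_self]

lemma tendsto_dilation_factor (m : ℕ) (z : ℂ) :
    Tendsto (fun t : ℝ => ((t⁻¹ : ℝ) : ℂ) * ((((1 + t) ^ m : ℝ) : ℂ) ^ z - 1)) (𝓝[≠] 0)
      (𝓝 (m * z)) := by
  have hder : HasDerivAt (fun t : ℝ => (((1 + t) ^ m : ℝ) : ℂ) ^ z) (m * z) 0 := by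
    have h : HasDerivAt (fun w : ℂ => ((1 + w) ^ m) ^ z) (m * z) ((0 : ℝ) : ℂ) := by
      have h1 : HasDerivAt (fun w : ℂ => (1 + w) ^ m) (m : ℂ) ((0 : ℝ) : ℂ) := by
        simpa using ((hasDerivAt_id ((0 : ℝ) : ℂ)).const_add 1).fun_pow m
      have h2 := h1.cpow_const (c := z) (by simp)
      simpa [mul_comm] using h2
    simpa using h.comp_ofReal
  have h := hasDerivAt_iff_tendsto_slope_zero.1 hder
  simpa using h

lemma exists_dilation_derivative (hπ : IsIrredAdmSmoothRep π) {M : ℝ}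
    (hint : ∀ (v : V) (s : ℂ), M < s.re → Integrable (integrand π ℓ v s) dg)
    (hbound : ∀ σ : ℝ, M < σ → ∃ β : Seminorm ℂ V, Continuous β ∧
        ∀ (v : V) (s : ℂ), s.re = σ → ‖L dg π ℓ v s‖ ≤ β v) :
    ∃ E : V →L[ℂ] V, ∀ (v : V) (s : ℂ), M < s.re →
      L dg π ℓ (E v) s = (n * Module.finrank ℝ F : ℕ) * (1 / 2 - s) * L dg π ℓ v s := by
  have hpos : ∀ᶠ t in 𝓝[≠] (0 : ℝ), 0 < 1 + t := by
    refine eventually_nhdsWithin_of_eventually_nhds ?_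
    filter_upwards [eventually_gt_nhds (show (-1 : ℝ) < 0 by norm_num)] with t ht
    linarith
  obtain ⟨E, hE⟩ := exists_derivative hπ.smooth (γ := fun t => nu (dilation F n t))
    (hpos.mono fun t ht => nu_dilation_val ht.ne')
  refine ⟨E, fun v s hs => ?_⟩
  obtain ⟨β, hβ, hle⟩ := hbound s.re hs
  let Λ : V →ₗ[ℂ] ℂ :=
    { toFun := fun v => L dg π ℓ v s
      map_add' := fun v w => L_add (hint v s hs) (hint w s hs)
      map_smul' := fun c v => L_smul dg c v s }
  -- The vertical line bound makes `L` continuous in `v`, so it commutes with the limit defining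
  -- `E`.
  have hcont : Continuous Λ := by
    have : Continuous ((normSeminorm ℂ ℂ).comp Λ) :=
      Seminorm.continuous_of_le hβ fun v => hle v s rfl
    refine continuous_of_continuousAt_zero Λ ?_
    rw [ContinuousAt, map_zero, tendsto_zero_iff_norm_tendsto_zero]
    have h0 := this.tendsto 0
    rw [map_zero] at h0
    exact h0
  refine tendsto_nhds_unique ((hcont.tendsto (E v)).comp (hE v)) ?_
  refine ((tendsto_dilation_factor (n * Module.finrank ℝ F) (1 / 2 - s)).mul_const
    (L dg π ℓ v s)).congr' ?_
  filter_upwards [hpos] with t ht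
  rw [Function.comp_apply, map_smul, map_sub]
  change _ = ((t⁻¹ : ℝ) : ℂ) * (L dg π ℓ (π (nu (dilation F n t)) v) s - L dg π ℓ v s)
  rw [L_dilation dg v s ht]
  ring

lemma exists_polynomial_operator (hn : 0 < n) {M : ℝ}
    (hint : ∀ (v : V) (s : ℂ), M < s.re → Integrable (integrand π ℓ v s) dg)
    {E : V →L[ℂ] V} (hE : ∀ (v : V) (s : ℂ), M < s.re →
      L dg π ℓ (E v) s = (n * Module.finrank ℝ F : ℕ) * (1 / 2 - s) * L dg π ℓ v s)
    (p : Polynomial ℂ) :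
    ∃ D : V →L[ℂ] V, ∀ (v : V) (s : ℂ), M < s.re →
      p.eval s * L dg π ℓ v s = L dg π ℓ (D v) s := by
  have hm : ((n * Module.finrank ℝ F : ℕ) : ℂ) ≠ 0 := by
    exact_mod_cast (Nat.mul_pos hn Module.finrank_pos).ne'
  induction p using Polynomial.induction_on' with
  | add p q hp hq =>
    obtain ⟨D₁, h₁⟩ := hp
    obtain ⟨D₂, h₂⟩ := hq
    exact ⟨D₁ + D₂, fun v s hs => by
      rw [Polynomial.eval_add, add_mul, h₁ v s hs, h₂ v s hs, _root_.add_apply, L_add (hint _ s hs) (hint _ s hs)]⟩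
  | monomial k a =>
    induction k with
    | zero => exact ⟨a • 1, fun v s _ => by simp [L_smul]⟩
    | succ k ih =>
      obtain ⟨D, hD⟩ := ih
      -- With `m = n * finrank ℝ F`, this is `s = 1/2 - m⁻¹ * (m * (1/2 - s))`, where `E` realizes
      -- the last factor.
      refine ⟨(1 / 2 : ℂ) • D - ((n * Module.finrank ℝ F : ℕ) : ℂ)⁻¹ • (E * D),
        fun v s hs => ?_⟩
      rw [sub_eq_add_neg, ← neg_smul, _root_.add_apply, _root_.smul_apply, _root_.smul_apply,
        mul_apply_eq_comp, L_add (hint _ s hs) (hint _ s hs), L_smul, L_smul, hE _ _ hs, ← hD v s hs]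
      simp only [Polynomial.eval_monomial]
      field_simp
      ring

end Integral

end Shalika

theorem theorem3p7 {F : Type*} [RCLike F] (n : ℕ) (hn : 0 < n)
    -- a Haar measure on `GL_n(F)`
    [MeasurableSpace (GL (Fin n) F)] [BorelSpace (GL (Fin n) F)]
    (dg : Measure (GL (Fin n) F)) [dg.IsHaarMeasure]
    -- a Fréchet space `V`
    {V : Type*} [AddCommGroup V] [Module ℂ V] [UniformSpace V] [IsUniformAddGroup V]
    [ContinuousSMul ℂ V] [LocallyConvexSpace ℝ V] [T2Space V] [FirstCountableTopology V]
    [CompleteSpace V]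
    (π : GL (Fin n ⊕ Fin n) F →* (V →L[ℂ] V)) (hπ : Shalika.IsIrredAdmSmoothRep π)
    (ℓ : V →L[ℂ] ℂ) (hℓ : Shalika.IsShalikaFunctional π ℓ) :
    ∃ M : ℝ, 0 < M ∧
      (∀ (v : V) (s : ℂ), M < s.re → Integrable (Shalika.integrand π ℓ v s) dg) ∧
      ∀ M' : ℕ, Even M' → 2 ≤ M' → ∀ p : Polynomial ℂ,
        ∃ β : Seminorm ℂ V, Continuous β ∧
          ∀ (v : V) (s : ℂ), s.re = M' + M → ‖p.eval s * Shalika.L dg π ℓ v s‖ ≤ β v := by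
  obtain ⟨M, hM, hint, hbound⟩ := Shalika.exists_abscissa dg hπ hℓ
  obtain ⟨E, hE⟩ := Shalika.exists_dilation_derivative dg hπ hint hbound
  refine ⟨M, hM, hint, fun M' _ hM' p => ?_⟩
  obtain ⟨D, hD⟩ := Shalika.exists_polynomial_operator dg hn hint hE p
  have hlt : M < M' + M := by
    have : (2 : ℝ) ≤ M' := by exact_mod_cast hM'
    linarith
  -- The polynomial is now inside `D`, so the bound on the single line `re s = M' + M` suffices.
  obtain ⟨β, hβ, hle⟩ := hbound (M' + M) hlt
  refine ⟨β.comp D.toLinearMap, hβ.comp D.continuous, fun v s hs => ?_⟩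
  rw [hD v s (hs ▸ hlt)]
  exact hle (D v) s hs
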